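/- Let $K$ be a field of characteristic $0$, let $Y=\{y_1,\ldots,y_m\}$, and let $\delta$ be a Weitzenböck derivation of the polynomial algebra $K[Y]$, i.e. a $K$-linear derivation which maps the vector space $KY$ with basis $Y$ into itself and is locally nilpotent (for every $u\in K[Y]$ there is a $p$ with $\delta^p(u)=0$). Assume that the Jordan normal form of the operator $\delta|_{KY}$ consists of $k$ cells, of sizes $d_1+1,\ldots,d_k+1$. Let \[ f_\delta(x_1,x_2,t)=\frac{1}{q_{d_1}(x_1,x_2,t)\cdots q_{d_k}(x_1,x_2,t)},\qquad q_d(x_1,x_2,t)=\prod_{a+b=d}\bigl(1-x_1^a x_2^b t\bigr), \] where the product runs over the integers $a,b\ge 0$ with $a+b=d$, and $f_\delta$ is regarded as an element of $K(t)[[x_1,x_2]]$. Then $f_\delta$ is symmetric in $x_1,x_2$. Write \[ f_\delta=\sum_{\lambda_1\ge\lambda_2\ge 0} m(\lambda)\,S_\lambda(x_1,x_2),\qquad m(\lambda)\in K(t), \] where \[ S_\lambda(x_1,x_2)=\frac{x_1^{\lambda_1+1}x_2^{\lambda_2}-x_2^{\lambda_1+1}x_1^{\lambda_2}}{x_1-x_2}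 \] are the Schur functions (the multiplicities $m(\lambda)$ are uniquely determined), and let $M(f_\delta;x_1,x_2)=\sum_\lambda m(\lambda)x_1^{\lambda_1}x_2^{\lambda_2}$ be the multiplicity series of $f_\delta$. Then the Hilbert series of the algebra of constants $K[Y]^\delta=\ker\delta$ is \[ H(K[Y]^\delta;t)=\sum_{n\ge 0}\dim_K\bigl(K[Y]^\delta\cap K[Y]_n\bigr)t^n=M(f_\delta;1,1)=\sum_\lambda m(\lambda), \] where $K[Y]_n$ is the space of homogeneous polynomials of degree $n$ and the last sum converges in the $t$-adic topology of $K((t))\supset K(t)$. -/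

import Mathlib

open MvPolynomial

/-! ### Schur functions and multiplicity series in two variables -/

/-- The alternant `V(μ, X) = det (x_j ^ μ_i)` in the variables `x_1, …, x_d`. -/
noncomputable def alternant (R : Type*) [CommRing R] {d : ℕ} (μ : Fin d → ℕ) :
    MvPolynomial (Fin d) R :=
  Matrix.det (Matrix.of fun i j : Fin d => (X j : MvPolynomial (Fin d) R) ^ μ i)

/-- The Schur function `S_{(a,b)}(x_1,x_2)` of a partition `(a, b)`, `a ≥ b`, in two variables:
`x_1^a x_2^b + x_1^(a-1) x_2^(b+1) + … + x_1^b x_2^a`. It is the quotient of the alternants of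
`(a + 1, b)` and `(1, 0)`, see `schurTwo_mul_alternant`. -/
noncomputable def schurTwo (R : Type*) [CommRing R] (a b : ℕ) : MvPolynomial (Fin 2) R :=
  ∑ i ∈ Finset.range (a - b + 1), X 0 ^ (a - i) * X 1 ^ (b + i)

theorem schurTwo_mul_alternant (R : Type*) [CommRing R] (a b : ℕ) (h : b ≤ a) :
    schurTwo R a b * alternant R ![1, 0] = alternant R ![a + 1, b] := by
  obtain ⟨c, rfl⟩ := Nat.exists_eq_add_of_le h
  have key : ∀ c : ℕ, (∑ i ∈ Finset.range (c + 1),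
      (X 0 : MvPolynomial (Fin 2) R) ^ (b + c - i) * X 1 ^ (b + i)) * (X 0 - X 1)
      = X 0 ^ (b + c + 1) * X 1 ^ b - X 1 ^ (b + c + 1) * X 0 ^ b := by
    intro c
    induction c with
    | zero => simp; ring
    | succ c ih =>
      rw [Finset.sum_range_succ]
      have : ∑ i ∈ Finset.range (c + 1),
          (X 0 : MvPolynomial (Fin 2) R) ^ (b + (c + 1) - i) * X 1 ^ (b + i)
          = X 0 * ∑ i ∈ Finset.range (c + 1),
            (X 0 : MvPolynomial (Fin 2) R) ^ (b + c - i) * X 1 ^ (b + i) := by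
        rw [Finset.mul_sum]
        refine Finset.sum_congr rfl fun i hi => ?_
        have hi' := Finset.mem_range.mp hi
        rw [show b + (c + 1) - i = (b + c - i) + 1 by omega, pow_succ]
        ring
      rw [this, add_mul, mul_assoc, ih, show b + (c + 1) - (c + 1) = b by omega]
      ring
  simp only [schurTwo, alternant, Matrix.det_fin_two]
  have := key c
  simp only [show b + c - b + 1 = c + 1 by omega]
  simpa using this

/-- The exponent vector of the monomial `x_1^a x_2^b`. -/
noncomputable def expo (a b : ℕ) : Fin 2 →₀ ℕ := Finsupp.single 0 a + Finsupp.single 1 b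

@[simp] theorem expo_zero (a b : ℕ) : expo a b 0 = a := by simp [expo]

@[simp] theorem expo_one (a b : ℕ) : expo a b 1 = b := by simp [expo]

theorem expo_eta (n : Fin 2 →₀ ℕ) : expo (n 0) (n 1) = n := by
  ext i; fin_cases i <;> simp

theorem coeff_schurTwo (R : Type*) [CommRing R] (a b : ℕ) (h : b ≤ a) (n : Fin 2 →₀ ℕ) :
    MvPolynomial.coeff n (schurTwo R a b)
      = if n 0 + n 1 = a + b ∧ b ≤ n 0 ∧ b ≤ n 1 then 1 else 0 := by
  have hm : ∀ i, (X 0 : MvPolynomial (Fin 2) R) ^ (a - i) * X 1 ^ (b + i)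
      = monomial (expo (a - i) (b + i)) 1 := by
    intro i
    rw [X_pow_eq_monomial, X_pow_eq_monomial, monomial_mul, expo, one_mul]
  have hc : ∀ i, expo (a - i) (b + i) = n ↔ a - i = n 0 ∧ b + i = n 1 := by
    intro i
    constructor
    · rintro rfl; simp
    · rintro ⟨h0, h1⟩; rw [h0, h1, expo_eta]
  simp only [schurTwo, coeff_sum, hm, coeff_monomial, hc]
  split_ifs with hn
  · rw [Finset.sum_eq_single (n 1 - b)]
    · rw [if_pos]; omega
    · intro i _ hi; rw [if_neg]; omega
    · intro hi; rw [Finset.mem_range] at hi; omega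
  · refine Finset.sum_eq_zero fun i hi => ?_
    rw [Finset.mem_range] at hi
    rw [if_neg]; omega

/-- `f ∈ R[[x_1, …, x_d]]` is symmetric: its coefficients are invariant under the permutations of
the exponents. -/
def IsSymmetricSeries {R : Type*} [CommRing R] {d : ℕ} (f : MvPowerSeries (Fin d) R) : Prop :=
  ∀ (e : Equiv.Perm (Fin d)) (n : Fin d →₀ ℕ),
    MvPowerSeries.coeff (n.mapDomain e) f = MvPowerSeries.coeff n f

/-- `M = ∑ m(λ) x^λ` (sum over the partitions `λ = (λ_1 ≥ λ_2)`) is a multiplicity series of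
`f ∈ R[[x_1,x_2]]`, that is, `f = ∑ m(λ) S_λ(x_1,x_2)`. As `S_λ` is homogeneous of degree
`λ_1 + λ_2`, only the finitely many partitions of `n_1 + n_2` contribute to the coefficient of
`x_1^n_1 x_2^n_2` on the right hand side. -/
structure IsMultiplicitySeries {R : Type*} [CommRing R] (f M : MvPowerSeries (Fin 2) R) :
    Prop where
  support : ∀ n : Fin 2 →₀ ℕ, n 0 < n 1 → MvPowerSeries.coeff n M = 0
  expansion : ∀ n : Fin 2 →₀ ℕ, MvPowerSeries.coeff n f =
    ∑ l ∈ Finset.HasAntidiagonal.antidiagonal (n 0 + n 1) with l.2 ≤ l.1,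
      MvPowerSeries.coeff (expo l.1 l.2) M * MvPolynomial.coeff n (schurTwo R l.1 l.2)

open Classical in
/-- The multiplicity series `M(f; x_1, x_2)`. For symmetric `f` it is the unique series with
`IsMultiplicitySeries f M`, see `existsUnique_isMultiplicitySeries`. -/
noncomputable def multiplicitySeries {R : Type*} [CommRing R] (f : MvPowerSeries (Fin 2) R) :
    MvPowerSeries (Fin 2) R :=
  if h : ∃ M, IsMultiplicitySeries f M then h.choose else 0

theorem multiplicity_sum_eq {R : Type*} [CommRing R] (M : MvPowerSeries (Fin 2) R)
    (n : Fin 2 →₀ ℕ) :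
    ∑ l ∈ Finset.HasAntidiagonal.antidiagonal (n 0 + n 1) with l.2 ≤ l.1,
      MvPowerSeries.coeff (expo l.1 l.2) M * MvPolynomial.coeff n (schurTwo R l.1 l.2)
    = ∑ j ∈ Finset.range (min (n 0) (n 1) + 1),
        MvPowerSeries.coeff (expo (n 0 + n 1 - j) j) M := by
  symm
  refine Finset.sum_of_injOn (fun j => (n 0 + n 1 - j, j)) ?_ ?_ ?_ ?_
  · intro a _ b _ hab
    exact (Prod.mk.inj hab).2
  · intro j hj
    simp only [Finset.coe_range, Set.mem_Iio] at hj
    simp only [Finset.coe_filter, Finset.HasAntidiagonal.mem_antidiagonal, Set.mem_ofPred_eq]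
    omega
  · rintro ⟨a, b⟩ hab hn
    simp only [Finset.mem_filter, Finset.HasAntidiagonal.mem_antidiagonal] at hab
    rw [coeff_schurTwo _ _ _ (by omega), if_neg, mul_zero]
    intro h
    refine hn ⟨b, ?_, ?_⟩
    · simp only [Finset.coe_range, Set.mem_Iio]
      omega
    · simp only [Prod.mk.injEq, and_true]
      omega
  · intro j hj
    simp only [Finset.mem_range] at hj
    rw [coeff_schurTwo _ _ _ (by omega), if_pos (by omega), mul_one]

/-- Every symmetric series has exactly one multiplicity series. -/
theorem existsUnique_isMultiplicitySeries {R : Type*} [CommRing R] (f : MvPowerSeries (Fin 2) R)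
    (hf : IsSymmetricSeries f) : ∃! M, IsMultiplicitySeries f M := by
  have hsw : ∀ a b, MvPowerSeries.coeff (expo a b) f = MvPowerSeries.coeff (expo b a) f := by
    intro a b
    rw [← hf (Equiv.swap 0 1) (expo b a)]
    congr 1
    simp [expo, Finsupp.mapDomain_add, Finsupp.mapDomain_single, add_comm]
  obtain ⟨M, hM⟩ : ∃ M : MvPowerSeries (Fin 2) R, ∀ n, MvPowerSeries.coeff n M =
      if n 0 < n 1 then 0 else MvPowerSeries.coeff n f -
        if n 1 = 0 then 0 else MvPowerSeries.coeff (expo (n 0 + 1) (n 1 - 1)) f :=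
    ⟨fun n => if n 0 < n 1 then 0 else MvPowerSeries.coeff n f -
      if n 1 = 0 then 0 else MvPowerSeries.coeff (expo (n 0 + 1) (n 1 - 1)) f, fun n => rfl⟩
  refine ⟨M, ⟨?_, ?_⟩, ?_⟩
  · intro n hn
    rw [hM, if_pos hn]
  · intro n
    rw [multiplicity_sum_eq]
    have key : ∀ N k, 2 * k ≤ N →
        ∑ j ∈ Finset.range (k + 1), MvPowerSeries.coeff (expo (N - j) j) M
        = MvPowerSeries.coeff (expo (N - k) k) f := by
      intro N k
      induction k with
      | zero =>
        intro _
        rw [zero_add, Finset.sum_range_one, hM]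
        simp
      | succ k ih =>
        intro hk
        rw [Finset.sum_range_succ, ih (by omega), hM, if_neg (by simp; omega), if_neg (by simp)]
        simp only [expo_zero, expo_one, Nat.add_sub_cancel]
        rw [show N - (k + 1) + 1 = N - k by omega]
        ring
    rw [key _ _ (by omega)]
    rcases le_total (n 0) (n 1) with h | h
    · rw [min_eq_left h, Nat.add_sub_cancel_left, hsw, expo_eta]
    · rw [min_eq_right h, Nat.add_sub_cancel, expo_eta]
  · intro M' hM'
    have hs : ∀ a b, b ≤ a → MvPowerSeries.coeff (expo a b) f
        = ∑ j ∈ Finset.range (b + 1), MvPowerSeries.coeff (expo (a + b - j) j) M' := by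
      intro a b h
      have := hM'.expansion (expo a b)
      rw [multiplicity_sum_eq] at this
      simpa [min_eq_right h] using this
    ext n
    rw [hM]
    split_ifs with h1 h2
    · exact hM'.support n h1
    · have e1 := hs (n 0) (n 1) (by omega)
      rw [expo_eta, h2, zero_add, Finset.sum_range_one, add_zero, Nat.sub_zero] at e1
      rw [e1, sub_zero, ← h2, expo_eta]
    · have e1 := hs (n 0) (n 1) (by omega)
      have e2 := hs (n 0 + 1) (n 1 - 1) (by omega)
      rw [Finset.sum_range_succ, expo_eta, Nat.add_sub_cancel, expo_eta] at e1
      rw [show n 1 - 1 + 1 = n 1 by omega,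
        show n 0 + 1 + (n 1 - 1) = n 0 + n 1 by omega] at e2
      rw [e1, e2]; ring

theorem isMultiplicitySeries_multiplicitySeries {R : Type*} [CommRing R]
    (f : MvPowerSeries (Fin 2) R) (hf : IsSymmetricSeries f) :
    IsMultiplicitySeries f (multiplicitySeries f) := by
  have h := (existsUnique_isMultiplicitySeries f hf).exists
  rw [multiplicitySeries, dif_pos h]
  exact h.choose_spec

/-- The series `M ∈ K(t)[[x_1,x_2]]` has the value `h` at `(x_1,x_2) = (a_1,a_2)`: substituting
`a_1, a_2` for `x_1, x_2` gives a series of elements of `K((t)) ⊇ K(t)` which converges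
(unconditionally, in the `t`-adic topology) to `h`. -/
def HasValueAt {K : Type*} [Field K] (M : MvPowerSeries (Fin 2) (RatFunc K))
    (a : Fin 2 → LaurentSeries K) (h : LaurentSeries K) : Prop :=
  HasSum (fun n : Fin 2 →₀ ℕ =>
    ((MvPowerSeries.coeff n M : RatFunc K) : LaurentSeries K) * ∏ i, a i ^ n i) h

/-! ### The function `f_δ` -/

/-- `q_d(x_1,x_2,t) = ∏_{a+b=d} (1 - x_1^a x_2^b t)` as an element of `K(t)[[x_1,x_2]]`. -/
noncomputable def qSeries (K : Type*) [Field K] (d : ℕ) : MvPowerSeries (Fin 2) (RatFunc K) :=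
  ∏ p ∈ Finset.HasAntidiagonal.antidiagonal d,
    (1 - MvPowerSeries.X 0 ^ p.1 * MvPowerSeries.X 1 ^ p.2 * MvPowerSeries.C RatFunc.X)

/-- `f = 1 / (q_{d_1} ⋯ q_{d_k}) ∈ K(t)[[x_1,x_2]]`. -/
noncomputable def fSeries (K : Type*) [Field K] {k : ℕ} (d : Fin k → ℕ) :
    MvPowerSeries (Fin 2) (RatFunc K) :=
  (∏ i, qSeries K (d i))⁻¹

/-- The inverse in `fSeries` is a genuine one. -/
theorem prod_qSeries_mul_fSeries (K : Type*) [Field K] {k : ℕ} (d : Fin k → ℕ) :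
    (∏ i, qSeries K (d i)) * fSeries K d = 1 := by
  refine MvPowerSeries.mul_inv_cancel _ ?_
  simp only [qSeries, map_prod, Finset.prod_ne_zero_iff]
  rintro i - p -
  have h1 : (1 : RatFunc K) - RatFunc.X ≠ 0 := by
    intro h
    have h2 : (algebraMap (Polynomial K) (RatFunc K)) (1 - Polynomial.X) = 0 := by
      simpa using h
    have h3 := (map_eq_zero_iff _ (RatFunc.algebraMap_injective K)).mp h2
    have h4 := congrArg (fun p => Polynomial.coeff p 0) h3
    simp at h4
  rcases Nat.eq_zero_or_pos p.1 with h0 | h0 <;> rcases Nat.eq_zero_or_pos p.2 with h2 | h2 <;>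
    simp_all [Nat.pos_iff_ne_zero]

/-! ### Weitzenböck derivations -/

/-- The vector space `KY` of linear forms in `K[Y]`, `Y = {y_1, …, y_m}`. -/
noncomputable def linearForms (K : Type*) [Field K] (m : ℕ) :
    Submodule K (MvPolynomial (Fin m) K) :=
  Submodule.span K (Set.range X)

/-- `δ` is a Weitzenböck derivation of `K[Y]`: it acts on `KY` as a linear operator and is locally
nilpotent. -/
structure IsWeitzenboeck {K : Type*} [Field K] {m : ℕ}
    (δ : Derivation K (MvPolynomial (Fin m) K) (MvPolynomial (Fin m) K)) : Prop where
  linear : ∀ u ∈ linearForms K m, δ u ∈ linearForms K m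
  locallyNilpotent : ∀ u, ∃ p : ℕ, δ^[p] u = 0

/-- The linear operator on `KY` induced by a Weitzenböck derivation. -/
noncomputable def IsWeitzenboeck.onLinearForms {K : Type*} [Field K] {m : ℕ}
    {δ : Derivation K (MvPolynomial (Fin m) K) (MvPolynomial (Fin m) K)}
    (hδ : IsWeitzenboeck δ) : Module.End K (linearForms K m) :=
  (δ : MvPolynomial (Fin m) K →ₗ[K] MvPolynomial (Fin m) K).restrict hδ.linear

/-- The Jordan cell of size `s` with eigenvalue `μ`. -/
def jordanCell {K : Type*} [Field K] (μ : K) (s : ℕ) : Matrix (Fin s) (Fin s) K :=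
  Matrix.of fun i j => if i = j then μ else if (i : ℕ) + 1 = j then 1 else 0

/-- In some basis the matrix of `T` is block diagonal with `k` Jordan cells of sizes
`s_1, …, s_k`. -/
def HasJordanCells {K V : Type*} [Field K] [AddCommGroup V] [Module K V]
    (T : Module.End K V) {k : ℕ} (s : Fin k → ℕ) : Prop :=
  ∃ (b : Module.Basis (Σ i : Fin k, Fin (s i)) K V) (μ : Fin k → K),
    LinearMap.toMatrix b b T = Matrix.blockDiagonal' fun i => jordanCell (μ i) (s i)

/-- The algebra of constants `K[Y]^δ`, the kernel of `δ`. -/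
def constantsAlgebra {K : Type*} [Field K] {m : ℕ}
    (δ : Derivation K (MvPolynomial (Fin m) K) (MvPolynomial (Fin m) K)) :
    Subalgebra K (MvPolynomial (Fin m) K) where
  carrier := {u | δ u = 0}
  mul_mem' {u v} hu hv := by
    rw [Set.mem_ofPred_eq] at *
    rw [Derivation.leibniz, hu, hv, smul_zero, smul_zero, add_zero]
  add_mem' {u v} hu hv := by
    rw [Set.mem_ofPred_eq] at *
    rw [map_add, hu, hv, add_zero]
  algebraMap_mem' r := by
    rw [Set.mem_ofPred_eq, Derivation.map_algebraMap]

/-- The Hilbert series `∑ dim (A ∩ K[Y]_n) t^n` of a graded subalgebra `A` of `K[Y]`, where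
`K[Y]_n` is the space of homogeneous polynomials of degree `n`. -/
noncomputable def hilbertSeriesOf {K : Type*} [Field K] {m : ℕ}
    (A : Subalgebra K (MvPolynomial (Fin m) K)) : PowerSeries ℤ :=
  PowerSeries.mk fun n =>
    (Module.finrank K ↥(Subalgebra.toSubmodule A ⊓ homogeneousSubmodule (Fin m) K n) : ℤ)

/-! In a Jordan basis of the linear forms, `δ` becomes the derivation `E` shifting each cell down by
one; its eigenvalues vanish by local nilpotency. `E` extends to an `sl_2`-triple of derivations `E`,
`F`, `H` of the polynomial ring, for which monomials are weight vectors: in a cell of size `d + 1`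
the variable at position `j` has weight `d - 2j`. In a fixed degree `E` raises weights by 2, is
injective on negative weights and surjective onto positive ones (`raiseDer_injective`,
`exists_raiseDer_eq`). Hence its kernel lies in weights at least 0, `E` maps the part of weight at
least 0 onto the part of weight at least 2, and rank-nullity gives (`finrank_ker_raiseDer`): the
dimension of the constants of degree `N` is the number of monomials of degree `N` and weight at
least 0, minus the number of weight at least 2.

On the other side, give that variable the exponent `x_1^(d-j) x_2^j`. Then `f_δ` is the generating
function of monomials by degree and exponent (`map_fSeries_eq`), and the weight is the difference of
the two exponents. Since `m(a,b)` is the coefficient of `f_δ` at `(a,b)` minus that at `(a+1,b-1)`,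
where the second term is absent for `b = 0`, summing over `a ≥ b` yields at `t^N` the same
difference of two counts (`sum_coeff_cellMultiplicity`). The exponents in degree `N` are bounded, so
each power of `t` receives finitely many contributions and the sum converges. -/

/-! ### Representations of `sl_2` with locally nilpotent operators -/

section SlTwo

variable {K V : Type*} [Field K] [AddCommGroup V] [Module K V]

/-- The weight of `E ^ p w` for a weight vector `w`. -/
theorem weight_pow_apply {E H : Module.End K V} (hHE : H * E - E * H = E + E) {g : ℤ} {w : V}
    (hw : H w = (g : K) • w) (p : ℕ) :
    H ((E ^ p) w) = ((g + 2 * p : ℤ) : K) • (E ^ p) w := by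
  induction p with
  | zero => simp [hw]
  | succ p ih =>
    have h := congrArg (fun T : Module.End K V => T ((E ^ p) w)) hHE
    simp only [LinearMap.sub_apply, Module.End.mul_apply, ih, map_smul] at h
    rw [pow_succ', Module.End.mul_apply, sub_eq_iff_eq_add.mp h, LinearMap.add_apply,
      ← two_smul K, ← add_smul]
    congr 1
    push_cast
    ring

/-- Moving `F` to the left past each `E` leaves one `H`; the weights met are `g, g + 2, …, g + 2p`,
whose sum is `(p + 1)(g + p)`. This is nonzero for `g > 0` in characteristic 0, which drives both
descents below. -/
theorem pow_apply_lower {E F H : Module.End K V} (hEF : E * F - F * E = H)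
    (hHE : H * E - E * H = E + E) {g : ℤ} {w : V} (hw : H w = (g : K) • w) (p : ℕ) :
    (E ^ (p + 1)) (F w)
      = F ((E ^ (p + 1)) w) + (((p + 1) * (g + p) : ℤ) : K) • (E ^ p) w := by
  have hc : ∀ u, E (F u) = F (E u) + H u := by
    intro u
    rw [← hEF]
    simp
  induction p with
  | zero => simp [hc, hw]
  | succ p ih =>
    rw [pow_succ', Module.End.mul_apply, ih, map_add, hc, weight_pow_apply hHE hw, map_smul,
      ← Module.End.mul_apply E (E ^ p), ← Module.End.mul_apply E (E ^ (p + 1)), ← pow_succ',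
      ← pow_succ', add_assoc, ← add_smul]
    congr 2
    push_cast
    ring

theorem intCast_succ_mul_ne_zero [CharZero K] {g : ℤ} (hg : 0 < g) (p : ℕ) :
    (((p + 1) * (g + p) : ℤ) : K) ≠ 0 := by
  rw [Int.cast_ne_zero]
  positivity

/-- The raising operator is injective on negative weights. -/
theorem eq_zero_of_raise_eq_zero [CharZero K] {E F H : Module.End K V}
    (hEF : E * F - F * E = H) (hHF : H * F - F * H = -(F + F)) {g : ℤ} (hg : g < 0) {v : V}
    (hv : H v = (g : K) • v) (hE : E v = 0) {p : ℕ} (hp : (F ^ p) v = 0) : v = 0 := by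
  induction p with
  | zero => simpa using hp
  | succ p ih =>
    refine ih ?_
    -- The commutation rule for the opposite triple `(F, E, -H)`, where `v` has the positive weight
    -- `-g`. Since `E v = 0`, it makes `F ^ p v` vanish as soon as `F ^ (p + 1) v` does.
    have h := pow_apply_lower (E := F) (F := E) (H := -H) (g := -g) (w := v)
      (by rw [← hEF]; abel) (by rw [neg_mul, mul_neg, ← neg_sub', hHF, neg_neg])
      (by simp [hv]) p
    rw [hE, hp, map_zero, map_zero, zero_add] at h
    exact (smul_eq_zero.mp h.symm).resolve_left (intCast_succ_mul_ne_zero (by omega) p)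

/-- The raising operator is surjective onto positive weights; a preimage is found in any family of
subspaces compatible with the lowering operator. -/
theorem exists_raise_eq [CharZero K] {E F H : Module.End K V} (hEF : E * F - F * E = H)
    (hHE : H * E - E * H = E + E) {g : ℤ} (hg : 0 < g) {S T : Submodule K V}
    (hS : ∀ v ∈ S, H v = (g : K) • v) (hF : ∀ v ∈ S, F v ∈ T) (hE : ∀ v ∈ T, E v ∈ S)
    {w : V} (hw : w ∈ S) {p : ℕ} (hp : (E ^ p) w = 0) : ∃ u ∈ T, E u = w := by
  induction p generalizing w with
  | zero => exact ⟨0, T.zero_mem, by simpa using hp.symm⟩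
  | succ p ih =>
    set c : K := (((p + 1) * (g + p) : ℤ) : K)
    have hc : c ≠ 0 := intCast_succ_mul_ne_zero hg p
    have hu : c⁻¹ • F w ∈ T := T.smul_mem _ (hF w hw)
    -- Because `E ^ (p + 1) (F w) = c • E ^ p w`, subtracting `E (c⁻¹ • F w)` from `w` produces a
    -- vector already killed by `E ^ p`.
    obtain ⟨u, huT, hEu⟩ := ih (w := w - E (c⁻¹ • F w)) (S.sub_mem hw (hE _ hu)) (by
      have h := pow_apply_lower hEF hHE (hS w hw) p
      rw [hp, map_zero, zero_add] at h
      rw [map_sub, map_smul, map_smul, ← Module.End.mul_apply, ← pow_succ, h, smul_smul,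
        inv_mul_cancel₀ hc, one_smul, sub_self])
    exact ⟨u + c⁻¹ • F w, T.add_mem huT hu, by rw [map_add, hEu, sub_add_cancel]⟩

end SlTwo

/-! ### Derivations of weighted graded polynomial rings -/

section WeightedDerivation

variable {R σ M : Type*} [CommRing R] [AddCommGroup M]

theorem MvPolynomial.IsWeightedHomogeneous.derivation {w : σ → M} {c : M}
    {D : Derivation R (MvPolynomial σ R) (MvPolynomial σ R)}
    (hD : ∀ i, IsWeightedHomogeneous w (D (X i)) (w i + c)) {p : MvPolynomial σ R} {n : M}
    (hp : IsWeightedHomogeneous w p n) : IsWeightedHomogeneous w (D p) (n + c) := by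
  classical
  rw [p.as_sum, map_sum]
  refine IsWeightedHomogeneous.sum _ _ _ fun s hs => ?_
  have hDm : D = mkDerivation R fun i => D (X i) := derivation_ext fun i => by simp
  rw [hDm, mkDerivation_monomial, Finsupp.sum]
  refine Submodule.smul_mem (weightedHomogeneousSubmodule R w (n + c)) _
    (Submodule.sum_mem _ fun i hi => ?_)
  rw [mem_weightedHomogeneousSubmodule, smul_eq_mul]
  have hs' : s - Finsupp.single i 1 + Finsupp.single i 1 = s :=
    tsub_add_cancel_of_le (Finsupp.single_le_iff.mpr
      (Nat.one_le_iff_ne_zero.mpr (Finsupp.mem_support_iff.mp hi)))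
  have hw : Finsupp.weight w (s - Finsupp.single i 1) + (w i + c) = n + c := by
    rw [← hp (mem_support_iff.mp hs)]
    conv_rhs => rw [← hs', map_add]
    rw [Finsupp.weight_single, one_smul, add_assoc]
  rw [← hw]
  exact (isWeightedHomogeneous_monomial w _ _ rfl).mul (hD i)

theorem MvPolynomial.IsWeightedHomogeneous.derivation_pow {w : σ → M} {c : M}
    {D : Derivation R (MvPolynomial σ R) (MvPolynomial σ R)}
    (hD : ∀ i, IsWeightedHomogeneous w (D (X i)) (w i + c)) {p : MvPolynomial σ R} {n : M}
    (hp : IsWeightedHomogeneous w p n) (k : ℕ) :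
    IsWeightedHomogeneous w (((D : Module.End R (MvPolynomial σ R)) ^ k) p) (n + k • c) := by
  induction k with
  | zero => simpa using hp
  | succ k ih =>
    rw [pow_succ', succ_nsmul, ← add_assoc]
    exact ih.derivation hD

theorem MvPolynomial.weightedHomogeneousComponent_derivation {w : σ → M} {c : M}
    {D : Derivation R (MvPolynomial σ R) (MvPolynomial σ R)}
    (hD : ∀ i, IsWeightedHomogeneous w (D (X i)) (w i + c)) (p : MvPolynomial σ R) (n : M) :
    weightedHomogeneousComponent w (n + c) (D p) = D (weightedHomogeneousComponent w n p) := by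
  induction p using MvPolynomial.induction_on' with
  | monomial s r =>
    have hm := isWeightedHomogeneous_monomial w s r rfl
    by_cases h : n = Finsupp.weight w s
    · subst h
      rw [hm.weightedHomogeneousComponent_same,
        (hm.derivation hD).weightedHomogeneousComponent_same]
    · rw [hm.weightedHomogeneousComponent_ne _ h, map_zero,
        (hm.derivation hD).weightedHomogeneousComponent_ne]
      simpa using h
  | add p q hp hq => simp only [map_add, hp, hq]

/-- Euler's identity: by the Leibniz rule the eigenvalues of the variables add up along a monomial,
as `φ` is additive. -/
theorem MvPolynomial.IsWeightedHomogeneous.derivation_eq_smul {w : σ → M} {φ : M →+ R}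
    {D : Derivation R (MvPolynomial σ R) (MvPolynomial σ R)}
    (hD : ∀ i, D (X i) = φ (w i) • X i) {p : MvPolynomial σ R} {n : M}
    (hp : IsWeightedHomogeneous w p n) : D p = φ n • p := by
  have key : ∀ s : σ →₀ ℕ, D (monomial s 1) = φ (Finsupp.weight w s) • monomial s 1 := by
    intro s
    induction s using Finsupp.induction_linear with
    | zero => simp [← C_apply]
    | add s t hs ht =>
      rw [← one_mul (1 : R), ← monomial_mul, Derivation.leibniz, hs, ht, map_add, map_add,
        add_smul, smul_eq_mul, smul_eq_mul, mul_smul_comm, mul_smul_comm, add_comm,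
        mul_comm (monomial t 1)]
    | single i k =>
      rw [← X_pow_eq_monomial]
      rcases k with _ | k
      · simp
      · rw [Derivation.leibniz_pow, hD, Finsupp.weight_single, map_nsmul, add_tsub_cancel_right,
          smul_eq_mul, mul_smul_comm, ← pow_succ, smul_assoc]
  conv_lhs => rw [p.as_sum]
  conv_rhs => rw [p.as_sum]
  rw [map_sum, Finset.smul_sum]
  exact Finset.sum_congr rfl fun s hs => by
    rw [← mul_one (coeff s p), ← smul_eq_mul, ← smul_monomial, D.map_smul, key,
      hp (mem_support_iff.mp hs), smul_comm]

end WeightedDerivation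

/-! ### The `sl_2`-action attached to the Jordan cells -/

section Cells

variable {k : ℕ}

/-- The positions of the basis vectors in a sequence of Jordan cells of sizes `d i + 1`. -/
abbrev CellIndex (d : Fin k → ℕ) : Type := Σ i : Fin k, Fin (d i + 1)

/-- The degree together with the `sl_2`-weight of the variables. -/
def cellWeight (d : Fin k → ℕ) (s : CellIndex d) : ℤ × ℤ := (1, d s.1 - 2 * (s.2 : ℕ))

/-- The monomials of degree `n` and `sl_2`-weight at least `c`. -/
def weightSet (d : Fin k → ℕ) (n : ℕ) (c : ℤ) : Set (CellIndex d →₀ ℕ) :=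
  {e | e.degree = n ∧ c ≤ (Finsupp.weight (cellWeight d) e).2}

theorem weight_cellWeight_fst (d : Fin k → ℕ) (e : CellIndex d →₀ ℕ) :
    (Finsupp.weight (cellWeight d) e).1 = e.degree := by
  simp [Finsupp.weight_apply, Finsupp.sum, Prod.fst_sum, cellWeight, Finsupp.degree_apply]

theorem weight_cellWeight_lower_bound (d : Fin k → ℕ) (e : CellIndex d →₀ ℕ) :
    |(Finsupp.weight (cellWeight d) e).2| ≤ e.degree * ∑ i, d i := by
  simp only [Finsupp.weight_apply, Finsupp.sum, Prod.snd_sum, cellWeight, Finsupp.degree_apply,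
    Prod.smul_mk, nsmul_eq_mul]
  refine (Finset.abs_sum_le_sum_abs _ _).trans ?_
  push_cast
  rw [Finset.sum_mul]
  refine Finset.sum_le_sum fun s _ => ?_
  rw [abs_mul, Nat.abs_cast]
  refine mul_le_mul_of_nonneg_left ?_ (by positivity)
  have h1 : d s.1 ≤ ∑ i, d i := Finset.single_le_sum (fun _ _ => Nat.zero_le _) (Finset.mem_univ _)
  have h2 := s.2.2
  rw [abs_le]
  have h3 : (d s.1 : ℤ) ≤ ∑ i, (d i : ℤ) := by exact_mod_cast h1
  constructor <;> omega

theorem finite_weightSet (d : Fin k → ℕ) (n : ℕ) (c : ℤ) : (weightSet d n c).Finite :=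
  (Finset.finite_toSet (Finset.univ.finsuppAntidiag n)).subset fun e he => by
    simp only [Finset.mem_coe, Finset.mem_finsuppAntidiag, Finset.subset_univ, and_true]
    rw [← he.1, Finsupp.degree_eq_sum]

variable (K : Type*) [Field K]

/-- The raising derivation, which shifts the variables of every cell down by one. -/
noncomputable def raiseDer (d : Fin k → ℕ) :
    Derivation K (MvPolynomial (CellIndex d) K) (MvPolynomial (CellIndex d) K) :=
  mkDerivation K fun s => if (s.2 : ℕ) = 0 then 0 else X ⟨s.1, ⟨s.2 - 1, by omega⟩⟩

/-- The lowering derivation. -/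
noncomputable def lowerDer (d : Fin k → ℕ) :
    Derivation K (MvPolynomial (CellIndex d) K) (MvPolynomial (CellIndex d) K) :=
  mkDerivation K fun s => if h : (s.2 : ℕ) + 1 < d s.1 + 1 then
    ((((s.2 : ℕ) + 1) * (d s.1 - (s.2 : ℕ)) : ℤ) : K) • X ⟨s.1, ⟨s.2 + 1, h⟩⟩ else 0

/-- The weight derivation. -/
noncomputable def weightDer (d : Fin k → ℕ) :
    Derivation K (MvPolynomial (CellIndex d) K) (MvPolynomial (CellIndex d) K) :=
  mkDerivation K fun s => ((d s.1 - 2 * (s.2 : ℕ) : ℤ) : K) • X s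

theorem raiseDer_X_homogeneous (d : Fin k → ℕ) (s : CellIndex d) :
    IsWeightedHomogeneous (cellWeight d) (raiseDer K d (X s)) (cellWeight d s + (0, 2)) := by
  rw [raiseDer, mkDerivation_X]
  split_ifs with h
  · exact isWeightedHomogeneous_zero _ _ _
  · convert isWeightedHomogeneous_X K (cellWeight d) _ using 1
    rw [cellWeight, cellWeight, Prod.mk_add_mk, add_zero, Prod.mk.injEq]
    refine ⟨rfl, ?_⟩
    dsimp only
    omega

theorem lowerDer_X_homogeneous (d : Fin k → ℕ) (s : CellIndex d) :
    IsWeightedHomogeneous (cellWeight d) (lowerDer K d (X s)) (cellWeight d s + (0, -2)) := by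
  rw [lowerDer, mkDerivation_X]
  split_ifs with h
  · refine Submodule.smul_mem (weightedHomogeneousSubmodule K _ _) _ ?_
    rw [mem_weightedHomogeneousSubmodule]
    convert isWeightedHomogeneous_X K (cellWeight d) _ using 1
    rw [cellWeight, cellWeight, Prod.mk_add_mk, add_zero, Prod.mk.injEq]
    refine ⟨rfl, ?_⟩
    dsimp only
    push_cast
    ring
  · exact isWeightedHomogeneous_zero _ _ _

/-- Derivations need only be compared on variables, where `(j + 1)(d - j) - j(d - j + 1) = d - 2j`;
this identity dictates the coefficients of `lowerDer`. The ends of a cell, where one term is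
missing, are separate cases. -/
theorem lie_raiseDer_lowerDer (d : Fin k → ℕ) : ⁅raiseDer K d, lowerDer K d⁆ = weightDer K d := by
  refine derivation_ext fun s => ?_
  obtain ⟨i, j, hj⟩ := s
  rw [Derivation.commutator_apply]
  simp only [raiseDer, lowerDer, weightDer, mkDerivation_X]
  split_ifs with h1 h2 h2
  · simp only [Derivation.map_smul, mkDerivation_X, map_zero, sub_zero]
    subst h2
    simp
  · rw [Derivation.map_smul, mkDerivation_X, mkDerivation_X, if_neg (by simp),
      dif_pos (by dsimp only; omega)]
    obtain ⟨j, rfl⟩ : ∃ l, j = l + 1 := ⟨j - 1, by omega⟩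
    simp only [Nat.add_sub_cancel, ← sub_smul]
    congr 1
    push_cast
    ring
  · simp [h2, show d i = 0 by omega]
  · rw [mkDerivation_X, dif_pos (by dsimp only; omega)]
    obtain ⟨j, rfl⟩ : ∃ l, j = l + 1 := ⟨j - 1, by omega⟩
    have h3 : d i = j + 1 := by omega
    simp only [Nat.add_sub_cancel, map_zero, zero_sub, ← neg_smul, h3]
    congr 1
    push_cast
    ring

theorem MvPolynomial.IsWeightedHomogeneous.weightDer_apply {d : Fin k → ℕ}
    {p : MvPolynomial (CellIndex d) K} {n : ℤ × ℤ}
    (hp : IsWeightedHomogeneous (cellWeight d) p n) : weightDer K d p = ((n.2 : ℤ) : K) • p :=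
  hp.derivation_eq_smul (φ := (Int.castAddHom K).comp (AddMonoidHom.snd ℤ ℤ))
    (fun s => by simp [weightDer, cellWeight])

theorem lie_weightDer {d : Fin k → ℕ} {c : ℤ}
    {D : Derivation K (MvPolynomial (CellIndex d) K) (MvPolynomial (CellIndex d) K)}
    (hD : ∀ s, IsWeightedHomogeneous (cellWeight d) (D (X s)) (cellWeight d s + (0, c))) :
    ⁅weightDer K d, D⁆ = (c : K) • D := by
  refine derivation_ext fun s => ?_
  rw [Derivation.commutator_apply, (hD s).weightDer_apply,
    (isWeightedHomogeneous_X K (cellWeight d) s).weightDer_apply, Derivation.map_smul,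
    ← sub_smul, Derivation.smul_apply]
  simp

theorem coe_commutator {A : Type*} [CommRing A] [Algebra K A] (D₁ D₂ : Derivation K A A) :
    (D₁ : Module.End K A) * D₂ - D₂ * D₁ = (⁅D₁, D₂⁆ : Derivation K A A) :=
  LinearMap.ext fun u => (Derivation.commutator_apply (D1 := D₁) (D2 := D₂) u).symm

/-- `D` keeps the degree and moves the weight by `c ≠ 0`, while the weights occurring in one degree
are bounded. -/
theorem exists_pow_apply_eq_zero {d : Fin k → ℕ} {c : ℤ} (hc : c ≠ 0)
    {D : Derivation K (MvPolynomial (CellIndex d) K) (MvPolynomial (CellIndex d) K)}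
    (hD : ∀ s, IsWeightedHomogeneous (cellWeight d) (D (X s)) (cellWeight d s + (0, c)))
    {p : MvPolynomial (CellIndex d) K} {n : ℤ × ℤ}
    (hp : IsWeightedHomogeneous (cellWeight d) p n) :
    ∃ l, ((D : Module.End K (MvPolynomial (CellIndex d) K)) ^ l) p = 0 := by
  obtain ⟨B, hB⟩ : ∃ B : ℤ, B = n.1 * ∑ i, d i := ⟨_, rfl⟩
  -- After this many steps the weight exceeds the bound `B` in absolute value, whatever the sign of
  -- `c` and of the initial weight.
  refine ⟨(|B| + |n.2| + 1).toNat, (hp.derivation_pow hD _).eq_zero_of_no_monomials fun e he => ?_⟩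
  have h1 := congrArg Prod.fst he
  have h2 := congrArg Prod.snd he
  have h3 := weight_cellWeight_lower_bound d e
  rw [← weight_cellWeight_fst d e, h1, h2] at h3
  simp only [Prod.snd_add, Prod.smul_snd, Prod.fst_add, Prod.smul_fst, smul_zero, add_zero,
    ← hB] at h3
  simp only [nsmul_eq_mul, Int.toNat_of_nonneg (show 0 ≤ |B| + |n.2| + 1 by positivity)] at h3
  have h4 : |B| + |n.2| + 1 ≤ |(|B| + |n.2| + 1) * c| := by
    rw [abs_mul, abs_of_pos (show 0 < |B| + |n.2| + 1 by positivity)]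
    exact le_mul_of_one_le_right (by positivity) (Int.one_le_abs hc)
  have h5 := abs_sub_abs_le_abs_sub ((|B| + |n.2| + 1) * c) (-n.2)
  rw [sub_neg_eq_add, abs_neg, add_comm _ n.2] at h5
  have h6 := le_abs_self B
  omega

theorem finrank_restrictSupport {σ : Type*} (S : Set (σ →₀ ℕ)) :
    Module.finrank K (restrictSupport K S) = S.ncard := by
  rw [Module.finrank_eq_nat_card_basis (basisRestrictSupport K S), Nat.card_coe_set_eq]

theorem raiseDer_mem_restrictSupport {d : Fin k → ℕ} {n : ℕ} {c : ℤ}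
    {p : MvPolynomial (CellIndex d) K} (hp : p ∈ restrictSupport K (weightSet d n c)) :
    raiseDer K d p ∈ restrictSupport K (weightSet d n (c + 2)) := by
  rw [p.as_sum, map_sum]
  refine Submodule.sum_mem _ fun e he => ?_
  have hm := (isWeightedHomogeneous_monomial (cellWeight d) e (coeff e p) rfl).derivation
    (raiseDer_X_homogeneous K d)
  rw [mem_restrictSupport_iff]
  intro e' he'
  have h := hm (mem_support_iff.mp he')
  have h1 := congrArg Prod.fst h
  have h2 := congrArg Prod.snd h
  have h3 := (mem_restrictSupport_iff K).mp hp he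
  simp only [Prod.fst_add, add_zero, weight_cellWeight_fst, Nat.cast_inj] at h1
  refine ⟨h1.trans h3.1, ?_⟩
  rw [h2]
  exact add_le_add_left h3.2 2

variable [CharZero K]

theorem raiseDer_injective {d : Fin k → ℕ} {n : ℤ × ℤ} (hn : n.2 < 0)
    {p : MvPolynomial (CellIndex d) K} (hp : IsWeightedHomogeneous (cellWeight d) p n)
    (h : raiseDer K d p = 0) : p = 0 := by
  obtain ⟨l, hl⟩ := exists_pow_apply_eq_zero K (by norm_num) (lowerDer_X_homogeneous K d) hp
  refine eq_zero_of_raise_eq_zero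
    (H := (weightDer K d : Module.End K (MvPolynomial (CellIndex d) K)))
    ?_ ?_ hn hp.weightDer_apply h hl
  · rw [coe_commutator, lie_raiseDer_lowerDer]
  · rw [coe_commutator, lie_weightDer K (lowerDer_X_homogeneous K d)]
    ext
    simp [two_mul]

theorem exists_raiseDer_eq {d : Fin k → ℕ} {n : ℤ × ℤ} (hn : 0 < n.2)
    {p : MvPolynomial (CellIndex d) K} (hp : IsWeightedHomogeneous (cellWeight d) p n) :
    ∃ q, IsWeightedHomogeneous (cellWeight d) q (n + (0, -2)) ∧ raiseDer K d q = p := by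
  obtain ⟨l, hl⟩ := exists_pow_apply_eq_zero K (by norm_num) (raiseDer_X_homogeneous K d) hp
  refine exists_raise_eq
    (F := (lowerDer K d : Module.End K (MvPolynomial (CellIndex d) K)))
    (H := (weightDer K d : Module.End K (MvPolynomial (CellIndex d) K)))
    (S := weightedHomogeneousSubmodule K (cellWeight d) n)
    (T := weightedHomogeneousSubmodule K (cellWeight d) (n + (0, -2)))
    ?_ ?_ hn ?_ ?_ ?_ hp hl
  · rw [coe_commutator, lie_raiseDer_lowerDer]
  · rw [coe_commutator, lie_weightDer K (raiseDer_X_homogeneous K d)]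
    ext
    simp [two_mul]
  · exact fun v hv => IsWeightedHomogeneous.weightDer_apply K hv
  · exact fun v hv => IsWeightedHomogeneous.derivation (lowerDer_X_homogeneous K d) hv
  · intro v hv
    have := IsWeightedHomogeneous.derivation (raiseDer_X_homogeneous K d) hv
    rwa [add_assoc, show ((0, -2) : ℤ × ℤ) + (0, 2) = 0 by rfl, add_zero] at this

/-- The dimension of the space of constants of degree `n`. -/
theorem finrank_ker_raiseDer (d : Fin k → ℕ) (n : ℕ) :
    Module.finrank K ↥(LinearMap.ker (raiseDer K d : Module.End K (MvPolynomial (CellIndex d) K))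
        ⊓ homogeneousSubmodule (CellIndex d) K n) + (weightSet d n 2).ncard
      = (weightSet d n 0).ncard := by
  obtain ⟨E, hE⟩ : ∃ E : Module.End K (MvPolynomial (CellIndex d) K),
    (raiseDer K d : Module.End K (MvPolynomial (CellIndex d) K)) = E := ⟨_, rfl⟩
  have hEa : ∀ p, E p = raiseDer K d p := fun p => by rw [← hE]; rfl
  rw [hE]
  have hmem : ∀ p ∈ restrictSupport K (weightSet d n 0),
      E p ∈ restrictSupport K (weightSet d n 2) := fun p hp => by
    have h := raiseDer_mem_restrictSupport K hp
    rwa [zero_add, ← hEa] at h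
  let L : restrictSupport K (weightSet d n 0) →ₗ[K] restrictSupport K (weightSet d n 2) :=
    E.restrict hmem
  -- A monomial of weight at least 2 has a positive weight, hence a homogeneous preimage, whose
  -- weight is 2 less and so still at least 0.
  have hsurj : LinearMap.range L = ⊤ := by
    have hle : restrictSupport K (weightSet d n 2)
        ≤ (restrictSupport K (weightSet d n 0)).map E := by
      rw [restrictSupport_eq_span, Submodule.span_le]
      rintro _ ⟨e, he, rfl⟩
      have hm := isWeightedHomogeneous_monomial (cellWeight d) e (1 : K) rfl
      obtain ⟨q, hq, hqe⟩ := exists_raiseDer_eq K (by have := he.2; omega) hm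
      refine ⟨q, ?_, (hEa q).trans hqe⟩
      rw [SetLike.mem_coe, mem_restrictSupport_iff]
      intro e' he'
      have h := hq (mem_support_iff.mp he')
      have h1 := congrArg Prod.fst h
      have h2 := congrArg Prod.snd h
      simp only [Prod.fst_add, add_zero, weight_cellWeight_fst, Nat.cast_inj] at h1
      refine ⟨h1.trans he.1, ?_⟩
      have := he.2
      rw [h2, Prod.snd_add]
      simp only
      omega
    rw [LinearMap.range_eq_top]
    rintro ⟨p, hp⟩
    obtain ⟨q, hq, rfl⟩ := hle hp
    exact ⟨⟨q, hq⟩, rfl⟩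
  have hker : (LinearMap.ker L).map (restrictSupport K (weightSet d n 0)).subtype
      = LinearMap.ker E ⊓ homogeneousSubmodule (CellIndex d) K n := by
    ext p
    simp only [Submodule.mem_map, Submodule.mem_inf, LinearMap.mem_ker, mem_homogeneousSubmodule]
    constructor
    · rintro ⟨⟨q, hq⟩, hLq, rfl⟩
      refine ⟨congrArg Subtype.val hLq, fun e he => ?_⟩
      rw [← ((mem_restrictSupport_iff K).mp hq (mem_support_iff.mpr he)).1]
      rw [Finsupp.degree_eq_weight_one]
      rfl
    · rintro ⟨hp, hpn⟩
      refine ⟨⟨p, ?_⟩, Subtype.ext hp, rfl⟩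
      rw [mem_restrictSupport_iff]
      intro e he
      rw [Finset.mem_coe, mem_support_iff] at he
      refine ⟨?_, ?_⟩
      · rw [← hpn he]
        rw [Finsupp.degree_eq_weight_one]
        rfl
      -- `E` commutes with taking weight components up to the shift, so every component of a
      -- constant is a constant; those of negative weight vanish by injectivity.
      · by_contra! hneg
        have h0 := raiseDer_injective K hneg
          (weightedHomogeneousComponent_isWeightedHomogeneous
            (Finsupp.weight (cellWeight d) e) p) (by
            rw [← weightedHomogeneousComponent_derivation (raiseDer_X_homogeneous K d)]
            exact (congrArg _ ((hEa p).symm.trans hp)).trans (map_zero _))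
        apply he
        have h1 := congrArg (coeff e) h0
        classical
        rwa [coeff_weightedHomogeneousComponent, if_pos rfl, coeff_zero] at h1
  have : Finite (weightSet d n 0) := finite_weightSet d n 0
  have : Module.Finite K (restrictSupport K (weightSet d n 0)) :=
    Module.Finite.of_basis (basisRestrictSupport K (weightSet d n 0))
  have h := L.finrank_range_add_finrank_ker
  rw [hsurj, finrank_top, finrank_restrictSupport, finrank_restrictSupport] at h
  rw [← hker, Submodule.finrank_map_subtype_eq, add_comm, h]

end Cells

/-! ### From a Weitzenböck derivation to the raising derivation -/

section Transport

variable {K : Type*} [Field K] {k : ℕ}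

theorem apply_jordanBasis {V : Type*} [AddCommGroup V] [Module K V] {T : Module.End K V}
    {d : Fin k → ℕ} {b : Module.Basis (CellIndex d) K V} {μ : Fin k → K}
    (h : LinearMap.toMatrix b b T = Matrix.blockDiagonal' fun i => jordanCell (μ i) (d i + 1))
    (s : CellIndex d) :
    T (b s) = μ s.1 • b s + if (s.2 : ℕ) = 0 then 0 else b ⟨s.1, ⟨s.2 - 1, by omega⟩⟩ := by
  obtain ⟨i, j⟩ := s
  rw [← Matrix.toLin_toMatrix b b T, Matrix.toLin_self, h, Fintype.sum_sigma,
    Finset.sum_eq_single i]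
  · simp only [Matrix.blockDiagonal'_apply_eq, jordanCell, Matrix.of_apply]
    rw [← Finset.add_sum_erase _ _ (Finset.mem_univ j), if_pos rfl]
    congr 1
    split_ifs with h0
    · refine Finset.sum_eq_zero fun l hl => ?_
      rw [if_neg (Finset.ne_of_mem_erase hl), if_neg (by omega), zero_smul]
    · have hj := j.2
      rw [Finset.sum_eq_single ⟨j - 1, by omega⟩]
      · rw [if_neg (by rw [Fin.ext_iff]; dsimp only; omega),
          if_pos (by dsimp only; omega), one_smul]
      · intro l hl hne
        rw [if_neg (Finset.ne_of_mem_erase hl),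
          if_neg (by rw [ne_eq, Fin.ext_iff] at hne; dsimp only at hne; omega), zero_smul]
      · intro hn
        refine absurd (Finset.mem_erase.mpr ⟨?_, Finset.mem_univ _⟩) hn
        rw [ne_eq, Fin.ext_iff]
        dsimp only
        omega
  · intro i' _ hi
    exact Finset.sum_eq_zero fun l _ => by rw [Matrix.blockDiagonal'_apply_ne _ _ _ hi, zero_smul]
  · simp

/-- The polynomial algebra generated by a basis of the space of linear forms. -/
noncomputable def linearFormsAlgEquiv {m : ℕ} {ι : Type*} [Fintype ι]
    (b : Module.Basis ι K (linearForms K m)) :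
    MvPolynomial ι K ≃ₐ[K] MvPolynomial (Fin m) K :=
  AlgEquiv.ofAlgHom (aeval fun s => (b s : MvPolynomial (Fin m) K))
    (aeval fun y => ∑ s, b.repr ⟨X y, Submodule.subset_span ⟨y, rfl⟩⟩ s • X s)
    (algHom_ext fun y => by
      have h := congrArg Subtype.val
        (b.sum_repr (⟨X y, Submodule.subset_span ⟨y, rfl⟩⟩ : linearForms K m))
      simp only [Submodule.coe_sum, Submodule.coe_smul] at h
      simpa only [AlgHom.comp_apply, aeval_X, map_sum, map_smul, AlgHom.id_apply] using h)
    (algHom_ext fun s => by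
      -- The inverse substitution sends every linear form to its coordinates in the basis `b`; for
      -- `u = b s` this is `X s`.
      have key : ∀ u : linearForms K m,
          aeval (fun y => ∑ s, b.repr ⟨X y, Submodule.subset_span ⟨y, rfl⟩⟩ s •
            (X s : MvPolynomial ι K)) (u : MvPolynomial (Fin m) K) = ∑ s, b.repr u s • X s := by
        rintro ⟨u, hu⟩
        induction hu using Submodule.span_induction with
        | mem x hx => obtain ⟨y, rfl⟩ := hx; simp
        | zero =>
          have h0 : (⟨0, Submodule.zero_mem _⟩ : linearForms K m) = 0 := rfl
          erw [h0]; simp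
        | add x y hx hy ihx ihy =>
          have h0 : (⟨x + y, Submodule.add_mem _ hx hy⟩ : linearForms K m)
            = ⟨x, hx⟩ + ⟨y, hy⟩ := rfl
          erw [h0]
          simp only [Submodule.coe_add, map_add, ihx, ihy, Finsupp.add_apply, add_smul,
            Finset.sum_add_distrib]
        | smul a x hx ih =>
          have h0 : (⟨a • x, Submodule.smul_mem _ a hx⟩ : linearForms K m) = a • ⟨x, hx⟩ := rfl
          erw [h0]
          simp only [Submodule.coe_smul, map_smul, ih, Finsupp.smul_apply, smul_assoc,
            Finset.smul_sum]
      rw [AlgHom.comp_apply, aeval_X, key]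
      rw [b.repr_self, Finset.sum_eq_single s]
      · simp
      · intro t _ ht
        rw [Finsupp.single_eq_of_ne ht, zero_smul]
      · simp)

theorem linearFormsAlgEquiv_X {m : ℕ} {ι : Type*} [Fintype ι]
    (b : Module.Basis ι K (linearForms K m)) (s : ι) : linearFormsAlgEquiv b (X s) = b s := by
  simp [linearFormsAlgEquiv]

theorem linearFormsAlgEquiv_mem_homogeneousSubmodule_iff {m : ℕ} {ι : Type*} [Fintype ι]
    (b : Module.Basis ι K (linearForms K m)) (n : ℕ) (p : MvPolynomial ι K) :
    linearFormsAlgEquiv b p ∈ homogeneousSubmodule (Fin m) K n ↔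
      p ∈ homogeneousSubmodule ι K n := by
  constructor
  · intro hp
    rw [← (linearFormsAlgEquiv b).symm_apply_apply p]
    have := IsHomogeneous.aeval (n := 1) hp
      (fun y => ∑ s, b.repr ⟨X y, Submodule.subset_span ⟨y, rfl⟩⟩ s • (X s : MvPolynomial ι K))
      (fun y => IsHomogeneous.sum _ _ _ fun s _ =>
        Submodule.smul_mem (homogeneousSubmodule ι K 1) _ (isHomogeneous_X K s))
    rw [one_mul] at this
    exact this
  · intro hp
    have := IsHomogeneous.aeval (n := 1) hp (fun s => (b s : MvPolynomial (Fin m) K)) fun s => by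
      rw [← mem_homogeneousSubmodule, homogeneousSubmodule_one_eq_span_X]
      exact (b s).2
    rw [one_mul] at this
    exact this

theorem IsWeitzenboeck.eigenvalue_eq_zero {m : ℕ}
    {δ : Derivation K (MvPolynomial (Fin m) K) (MvPolynomial (Fin m) K)} (hδ : IsWeitzenboeck δ)
    {v : linearForms K m} (hv : v ≠ 0) {μ : K} (h : hδ.onLinearForms v = μ • v) : μ = 0 := by
  have h1 : δ (v : MvPolynomial (Fin m) K) = μ • (v : MvPolynomial (Fin m) K) :=
    congrArg Subtype.val h
  have h2 : ∀ p : ℕ, δ^[p] (v : MvPolynomial (Fin m) K) = μ ^ p • (v : MvPolynomial (Fin m) K) := by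
    intro p
    induction p with
    | zero => simp
    | succ p ih => rw [Function.iterate_succ_apply', ih, δ.map_smul, h1, smul_smul, pow_succ]
  obtain ⟨p, hp⟩ := hδ.locallyNilpotent v
  rw [h2, smul_eq_zero] at hp
  exact eq_zero_of_pow_eq_zero (hp.resolve_right fun h => hv (Subtype.ext h))

theorem linearFormsAlgEquiv_raiseDer {m : ℕ}
    {δ : Derivation K (MvPolynomial (Fin m) K) (MvPolynomial (Fin m) K)} (hδ : IsWeitzenboeck δ)
    {d : Fin k → ℕ} {b : Module.Basis (CellIndex d) K (linearForms K m)} {μ : Fin k → K}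
    (h : LinearMap.toMatrix b b hδ.onLinearForms
      = Matrix.blockDiagonal' fun i => jordanCell (μ i) (d i + 1))
    (p : MvPolynomial (CellIndex d) K) :
    linearFormsAlgEquiv b (raiseDer K d p) = δ (linearFormsAlgEquiv b p) := by
  -- The vector at position 0 of a cell is an eigenvector; it exists because the cell has size `d i
  -- + 1 > 0`.
  have hμ : ∀ i, μ i = 0 := fun i =>
    hδ.eigenvalue_eq_zero (b.ne_zero ⟨i, 0⟩) (by rw [apply_jordanBasis h]; simp)
  have hX : ∀ s, linearFormsAlgEquiv b (raiseDer K d (X s)) = δ (linearFormsAlgEquiv b (X s)) := by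
    intro s
    have hs := congrArg Subtype.val (apply_jordanBasis h s)
    rw [hμ, zero_smul, zero_add] at hs
    rw [linearFormsAlgEquiv_X]
    refine Eq.trans ?_ hs.symm
    rw [raiseDer, mkDerivation_X]
    split_ifs
    · simp
    · rw [linearFormsAlgEquiv_X]
  induction p using MvPolynomial.induction_on with
  | C a =>
    rw [← algebraMap_eq, Derivation.map_algebraMap, AlgEquiv.commutes, Derivation.map_algebraMap,
      map_zero]
  | add p q hp hq => simp only [map_add, hp, hq]
  | mul_X p s hp =>
    rw [map_mul (linearFormsAlgEquiv b), Derivation.leibniz, Derivation.leibniz, map_add,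
      smul_eq_mul, smul_eq_mul, map_mul, map_mul, hp, hX, smul_eq_mul, smul_eq_mul]

/-- The dimension of the space of constants of degree `n`, counted by monomials. -/
theorem finrank_constantsAlgebra [CharZero K] {m : ℕ}
    {δ : Derivation K (MvPolynomial (Fin m) K) (MvPolynomial (Fin m) K)} (hδ : IsWeitzenboeck δ)
    {d : Fin k → ℕ} (hJ : HasJordanCells hδ.onLinearForms fun i => d i + 1) (n : ℕ) :
    Module.finrank K ↥(Subalgebra.toSubmodule (constantsAlgebra δ)
        ⊓ homogeneousSubmodule (Fin m) K n) + (weightSet d n 2).ncard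
      = (weightSet d n 0).ncard := by
  obtain ⟨b, μ, h⟩ := hJ
  rw [← finrank_ker_raiseDer K d n,
    ← LinearEquiv.finrank_map_eq (linearFormsAlgEquiv b).toLinearEquiv]
  suffices hmap : Subalgebra.toSubmodule (constantsAlgebra δ) ⊓ homogeneousSubmodule (Fin m) K n
      = (LinearMap.ker (raiseDer K d : Module.End K (MvPolynomial (CellIndex d) K))
        ⊓ homogeneousSubmodule (CellIndex d) K n).map
          ((linearFormsAlgEquiv b).toLinearEquiv : _ →ₗ[K] MvPolynomial (Fin m) K) by
    rw [hmap]
  ext u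
  obtain ⟨p, rfl⟩ := (linearFormsAlgEquiv b).surjective u
  rw [Submodule.mem_inf, linearFormsAlgEquiv_mem_homogeneousSubmodule_iff]
  have hmem : linearFormsAlgEquiv b p ∈ Subalgebra.toSubmodule (constantsAlgebra δ) ↔
      raiseDer K d p = 0 := by
    rw [← map_eq_zero_iff _ (linearFormsAlgEquiv b).injective, linearFormsAlgEquiv_raiseDer hδ h]
    rfl
  rw [hmem]
  constructor
  · rintro ⟨h1, h2⟩
    exact ⟨p, ⟨h1, h2⟩, rfl⟩
  · rintro ⟨q, ⟨h1, h2⟩, hq⟩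
    obtain rfl : q = p := (linearFormsAlgEquiv b).injective hq
    exact ⟨h1, h2⟩

end Transport

/-! ### Counting monomials by degree and exponent -/

section GeneratingFunction

variable {σ τ : Type*}

/-- The exponents of the monomials of degree `N` and weight `n` in the variables from `S`. -/
def multidegreeSet (w : σ → τ →₀ ℕ) (S : Set σ) (N : ℕ) (n : τ →₀ ℕ) : Set (σ →₀ ℕ) :=
  {e | (e.support : Set σ) ⊆ S ∧ e.degree = N ∧ Finsupp.weight w e = n}

theorem finite_multidegreeSet [Finite σ] (w : σ → τ →₀ ℕ) (S : Set σ) (N : ℕ) (n : τ →₀ ℕ) :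
    (multidegreeSet w S N n).Finite := by
  classical
  have := Fintype.ofFinite σ
  refine (Finset.finite_toSet (Finset.univ.finsuppAntidiag N)).subset fun e he => ?_
  simp only [Finset.mem_coe, Finset.mem_finsuppAntidiag, Finset.subset_univ, and_true]
  rw [← he.2.1, Finsupp.degree_eq_sum]

/-- The generating function of the monomials in the variables from `S`. -/
noncomputable def multidegreeSeries (K : Type*) [Semiring K] (w : σ → τ →₀ ℕ) (S : Set σ) :
    MvPowerSeries τ (PowerSeries K) :=
  fun n => PowerSeries.mk fun N => ((multidegreeSet w S N n).ncard : K)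

theorem coeff_multidegreeSeries (K : Type*) [Semiring K] (w : σ → τ →₀ ℕ) (S : Set σ) (n : τ →₀ ℕ)
    (N : ℕ) : PowerSeries.coeff N (MvPowerSeries.coeff n (multidegreeSeries K w S))
      = ((multidegreeSet w S N n).ncard : K) :=
  PowerSeries.coeff_mk N fun N => ((multidegreeSet w S N n).ncard : K)

theorem mem_multidegreeSet_insert_iff {w : σ → τ →₀ ℕ} {S : Set σ} {s : σ} (hs : s ∉ S) {N : ℕ}
    {n : τ →₀ ℕ} {e : σ →₀ ℕ} :
    e ∈ multidegreeSet w S N n ↔ e ∈ multidegreeSet w (insert s S) N n ∧ e s = 0 := by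
  constructor
  · rintro ⟨h1, h2⟩
    refine ⟨⟨h1.trans (Set.subset_insert _ _), h2⟩, ?_⟩
    by_contra h
    exact hs (h1 (Finsupp.mem_support_iff.mpr h))
  · rintro ⟨⟨h1, h2⟩, h3⟩
    refine ⟨fun t ht => (h1 ht).resolve_left ?_, h2⟩
    rintro rfl
    exact Finsupp.mem_support_iff.mp ht h3

theorem add_single_mem_multidegreeSet_iff {w : σ → τ →₀ ℕ} {S : Set σ} {s : σ} {N : ℕ}
    {n : τ →₀ ℕ} {e : σ →₀ ℕ} :
    e + Finsupp.single s 1 ∈ multidegreeSet w (insert s S) (N + 1) (n + w s)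
      ↔ e ∈ multidegreeSet w (insert s S) N n := by
  classical
  simp only [multidegreeSet, Set.mem_ofPred_eq, map_add, Finsupp.degree_single, add_left_inj,
    Finsupp.weight_single, one_smul]
  refine and_congr_left fun _ => ⟨fun h t ht => h ?_, fun h t ht => ?_⟩
  · simp only [Finset.mem_coe, Finsupp.mem_support_iff, Finsupp.add_apply] at ht ⊢
    omega
  · by_cases hts : t = s
    · exact Or.inl hts
    · refine h ?_
      simp only [Finset.mem_coe, Finsupp.mem_support_iff, Finsupp.add_apply,
        Finsupp.single_apply, if_neg (Ne.symm hts), add_zero] at ht ⊢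
      exact ht

/-- A monomial either avoids the variable `s` or is uniquely `X s` times another monomial. -/
theorem ncard_multidegreeSet_insert [Finite σ] {w : σ → τ →₀ ℕ} {S : Set σ} {s : σ} (hs : s ∉ S)
    (N : ℕ) (n : τ →₀ ℕ) :
    (multidegreeSet w (insert s S) (N + 1) (n + w s)).ncard
      = (multidegreeSet w S (N + 1) (n + w s)).ncard
        + (multidegreeSet w (insert s S) N n).ncard := by
  classical
  rw [← Set.ncard_image_of_injective (multidegreeSet w (insert s S) N n)
      (add_left_injective (Finsupp.single s 1)),
    ← Set.ncard_union_eq _ (finite_multidegreeSet _ _ _ _)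
      ((finite_multidegreeSet _ _ _ _).image _)]
  · congr 1
    ext e
    rw [Set.mem_union, mem_multidegreeSet_insert_iff hs, Set.mem_image]
    constructor
    · intro he
      by_cases h0 : e s = 0
      · exact Or.inl ⟨he, h0⟩
      · have h1 : e - Finsupp.single s 1 + Finsupp.single s 1 = e :=
          tsub_add_cancel_of_le (Finsupp.single_le_iff.mpr (Nat.one_le_iff_ne_zero.mpr h0))
        refine Or.inr ⟨_, ?_, h1⟩
        rwa [← add_single_mem_multidegreeSet_iff, h1]
    · rintro (h | ⟨e, he, rfl⟩)
      · exact h.1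
      · exact add_single_mem_multidegreeSet_iff.mpr he
  · rw [Set.disjoint_left]
    rintro e he ⟨e', -, rfl⟩
    simpa using ((mem_multidegreeSet_insert_iff hs).mp he).2

theorem multidegreeSet_insert_of_not_le {w : σ → τ →₀ ℕ} {S : Set σ} {s : σ} (hs : s ∉ S)
    {N : ℕ} {n : τ →₀ ℕ} (h : ¬(1 ≤ N ∧ w s ≤ n)) :
    multidegreeSet w (insert s S) N n = multidegreeSet w S N n := by
  classical
  ext e
  rw [mem_multidegreeSet_insert_iff hs, iff_self_and]
  rintro ⟨-, rfl, rfl⟩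
  by_contra h0
  have h1 : Finsupp.single s 1 ≤ e := Finsupp.single_le_iff.mpr (Nat.one_le_iff_ne_zero.mpr h0)
  obtain ⟨e', rfl⟩ := exists_add_of_le h1
  refine h ⟨?_, ?_⟩ <;> simp [Finsupp.weight_single]

/-- The factor belonging to `s` cancels the monomials divisible by `X s`; iterating removes all the
variables and leaves 1. -/
theorem sub_monomial_mul_multidegreeSeries [Finite σ] {K : Type*} [CommRing K] {w : σ → τ →₀ ℕ}
    {S : Set σ} {s : σ} (hs : s ∉ S) :
    (1 - MvPowerSeries.monomial (w s) PowerSeries.X) * multidegreeSeries K w (insert s S)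
      = multidegreeSeries K w S := by
  classical
  ext n N
  rw [sub_mul, one_mul, map_sub, map_sub, MvPowerSeries.coeff_monomial_mul]
  split_ifs with h
  · obtain ⟨n, rfl⟩ := exists_add_of_le h
    rcases N with _ | N
    · rw [PowerSeries.coeff_zero_X_mul, sub_zero, coeff_multidegreeSeries, coeff_multidegreeSeries,
        multidegreeSet_insert_of_not_le hs (by simp)]
    · rw [PowerSeries.coeff_succ_X_mul, add_tsub_cancel_left, add_comm (w s)]
      simp only [coeff_multidegreeSeries]
      rw [ncard_multidegreeSet_insert hs, Nat.cast_add, add_sub_cancel_right]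
  · rw [map_zero, sub_zero, coeff_multidegreeSeries, coeff_multidegreeSeries,
      multidegreeSet_insert_of_not_le hs (by simp [h])]

theorem prod_mul_multidegreeSeries [Finite σ] {K : Type*} [CommRing K] (w : σ → τ →₀ ℕ)
    (S : Finset σ) :
    (∏ s ∈ S, (1 - MvPowerSeries.monomial (w s) PowerSeries.X)) * multidegreeSeries K w S = 1 := by
  classical
  induction S using Finset.induction_on with
  | empty =>
    ext n N
    rw [Finset.prod_empty, one_mul, coeff_multidegreeSeries, MvPowerSeries.coeff_one]
    have h : multidegreeSet w (↑(∅ : Finset σ)) N n = if N = 0 ∧ n = 0 then {0} else ∅ := by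
      ext e
      simp only [multidegreeSet, Finset.coe_empty, Set.subset_empty_iff, Finset.coe_eq_empty,
        Finsupp.support_eq_empty, Set.mem_ofPred_eq]
      split_ifs with h
      · constructor
        · exact fun h => h.1
        · rintro rfl
          simp [h.1, h.2]
      · simp only [Set.mem_empty_iff_false, iff_false]
        rintro ⟨rfl, h1, h2⟩
        exact h ⟨by simpa using h1.symm, by simpa using h2.symm⟩
    rw [h]
    split_ifs with h1 h2 h2
    · simp [h1.1]
    · exact absurd h1.2 h2
    · rw [PowerSeries.coeff_one, if_neg (fun h3 => h1 ⟨h3, h2⟩)]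
      simp
    · simp
  | insert s S hs ih =>
    rw [Finset.prod_insert hs, mul_comm (1 - _), mul_assoc, Finset.coe_insert,
      sub_monomial_mul_multidegreeSeries (by simpa using hs), ih]

theorem ncard_multidegreeSet_mapDomain {w : σ → τ →₀ ℕ} (f : Equiv.Perm σ) (g : Equiv.Perm τ)
    (h : ∀ s, w (f s) = (w s).mapDomain g) (N : ℕ) (n : τ →₀ ℕ) :
    (multidegreeSet w Set.univ N (n.mapDomain g)).ncard
      = (multidegreeSet w Set.univ N n).ncard := by
  have hw : ∀ e : σ →₀ ℕ, Finsupp.weight w (e.mapDomain f) = (Finsupp.weight w e).mapDomain g := by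
    intro e
    induction e using Finsupp.induction_linear with
    | zero => simp
    | add a b ha hb => simp only [Finsupp.mapDomain_add, map_add, ha, hb]
    | single s c =>
      rw [Finsupp.mapDomain_single, Finsupp.weight_single, Finsupp.weight_single, h,
        Finsupp.mapDomain_smul]
  have hdeg : ∀ e : σ →₀ ℕ, (e.mapDomain f).degree = e.degree := by
    intro e
    induction e using Finsupp.induction_linear with
    | zero => simp
    | add a b ha hb => simp only [Finsupp.mapDomain_add, map_add, ha, hb]
    | single s c => rw [Finsupp.mapDomain_single, Finsupp.degree_single, Finsupp.degree_single]
  rw [← Set.ncard_image_of_injective (multidegreeSet w Set.univ N n)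
    (Finsupp.mapDomain_injective f.injective)]
  congr 1
  ext e
  obtain ⟨e, rfl⟩ : ∃ e', Finsupp.mapDomain f e' = e :=
    ⟨e.mapDomain f.symm, by rw [← Finsupp.mapDomain_comp]; simp⟩
  rw [(Finsupp.mapDomain_injective f.injective).mem_set_image]
  simp only [multidegreeSet, Set.mem_ofPred_eq, hw, hdeg,
    (Finsupp.mapDomain_injective g.injective).eq_iff, Set.subset_univ]

end GeneratingFunction

/-! ### The function `f_δ` as a generating function -/

section FSeries

open scoped RatFunc

variable {k : ℕ}

/-- The exponent of `x_1, x_2` attached to a variable. -/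
noncomputable def cellExpo (d : Fin k → ℕ) (s : CellIndex d) : Fin 2 →₀ ℕ :=
  expo (d s.1 - s.2) s.2

/-- The coefficients of `f_δ` are in `K(t)`, the counts in `K[[t]]`; the two are compared in a
common ring `L`, later `K((t))`. -/
theorem prod_qSeries_eq {K L : Type*} [Field K] [CommRing L] (φ : RatFunc K →+* L)
    (ψ : PowerSeries K →+* L) (h : φ RatFunc.X = ψ PowerSeries.X) (d : Fin k → ℕ) :
    MvPowerSeries.map φ (∏ i, qSeries K (d i)) = MvPowerSeries.map ψ
      (∏ s ∈ (Finset.univ : Finset (CellIndex d)),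
        (1 - MvPowerSeries.monomial (cellExpo d s) PowerSeries.X)) := by
  rw [Fintype.prod_sigma, map_prod, map_prod]
  refine Finset.prod_congr rfl fun i _ => ?_
  rw [qSeries, ← Finset.Nat.prod_antidiagonal_swap,
    Finset.Nat.prod_antidiagonal_eq_prod_range_succ_mk, Finset.prod_range, map_prod, map_prod]
  refine Finset.prod_congr rfl fun j _ => ?_
  simp only [Prod.swap_prod_mk, map_sub, map_one, map_mul, map_pow, MvPowerSeries.map_X,
    MvPowerSeries.map_C, MvPowerSeries.map_monomial, h]
  congr 1
  rw [MvPowerSeries.X_pow_eq, MvPowerSeries.X_pow_eq, MvPowerSeries.monomial_mul_monomial,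
    ← MvPowerSeries.monomial_zero_eq_C_apply, MvPowerSeries.monomial_mul_monomial, cellExpo, expo,
    add_zero, one_mul, one_mul]

theorem map_fSeries_eq {K L : Type*} [Field K] [CommRing L] (φ : RatFunc K →+* L)
    (ψ : PowerSeries K →+* L) (h : φ RatFunc.X = ψ PowerSeries.X) (d : Fin k → ℕ) :
    MvPowerSeries.map φ (fSeries K d)
      = MvPowerSeries.map ψ (multidegreeSeries K (cellExpo d) Set.univ) := by
  have h1 := congrArg (MvPowerSeries.map φ) (prod_qSeries_mul_fSeries K d)
  have h2 := congrArg (MvPowerSeries.map ψ)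
    (prod_mul_multidegreeSeries (K := K) (cellExpo d) Finset.univ)
  rw [map_mul, map_one] at h1 h2
  rw [← prod_qSeries_eq φ ψ h, Finset.coe_univ] at h2
  rw [mul_comm] at h1
  exact left_inv_eq_right_inv h1 h2

theorem ratFunc_coe_X_eq (K : Type*) [Field K] :
    algebraMap (RatFunc K) (LaurentSeries K) RatFunc.X
      = HahnSeries.ofPowerSeries ℤ K PowerSeries.X := by
  rw [PowerSeries.coe_X]
  exact RatFunc.coe_X

theorem coeff_fSeries_coe (K : Type*) [Field K] (d : Fin k → ℕ) (n : Fin 2 →₀ ℕ) :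
    algebraMap (RatFunc K) (LaurentSeries K) (MvPowerSeries.coeff n (fSeries K d))
      = HahnSeries.ofPowerSeries ℤ K
        (MvPowerSeries.coeff n (multidegreeSeries K (cellExpo d) Set.univ)) := by
  rw [← MvPowerSeries.coeff_map, map_fSeries_eq _ _ (ratFunc_coe_X_eq K), MvPowerSeries.coeff_map]

/-- Reversal of all cells. -/
def cellRev (d : Fin k → ℕ) : Equiv.Perm (CellIndex d) :=
  Equiv.sigmaCongrRight fun _ => Fin.revPerm

/-- Reversing every cell permutes the variables and exchanges the exponents of `x_1` and `x_2`, so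
the counts are symmetric; `K(t)` embeds in `K((t))`. -/
theorem isSymmetricSeries_fSeries (K : Type*) [Field K] (d : Fin k → ℕ) :
    IsSymmetricSeries (fSeries K d) := by
  intro g n
  apply (algebraMap (RatFunc K) (LaurentSeries K)).injective
  rw [coeff_fSeries_coe, coeff_fSeries_coe]
  congr 1
  ext N
  rw [coeff_multidegreeSeries, coeff_multidegreeSeries]
  congr 1
  have hg : g = 1 ∨ g = Equiv.swap 0 1 := by revert g; decide
  rcases hg with rfl | rfl
  · rw [Equiv.Perm.coe_one, Finsupp.mapDomain_id]
  · refine ncard_multidegreeSet_mapDomain (cellRev d) _ (fun s => ?_) N n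
    have h1 : ((cellRev d s).2 : ℕ) = d s.1 - s.2 := by
      change ((Fin.rev s.2 : Fin (d s.1 + 1)) : ℕ) = _
      rw [Fin.val_rev, Nat.add_sub_add_right]
    have h2 : (cellRev d s).1 = s.1 := rfl
    have h3 := s.2.2
    rw [cellExpo, cellExpo, h1, h2, Nat.sub_sub_self (by omega)]
    rw [expo, expo, Finsupp.mapDomain_add, Finsupp.mapDomain_single, Finsupp.mapDomain_single,
      Equiv.swap_apply_left, Equiv.swap_apply_right, add_comm]

end FSeries

/-! ### Summation in the `t`-adic topology and the formula for multiplicities -/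

section Evaluation

/-- A neighbourhood of the limit constrains only the coefficients below some `D`, and by
monotonicity every finite set containing `S D` already gets these right. -/
theorem hasSum_ofPowerSeries {K ι : Type*} [Field K] {P : ι → PowerSeries K} {h : PowerSeries K}
    (S : ℕ → Finset ι) (hmono : Monotone S) (hzero : ∀ N, ∀ i ∉ S N, PowerSeries.coeff N (P i) = 0)
    (hsum : ∀ N, ∑ i ∈ S N, PowerSeries.coeff N (P i) = PowerSeries.coeff N h) :
    HasSum (fun i => (P i : LaurentSeries K)) (h : LaurentSeries K) := by
  intro U hU
  obtain ⟨γ, hγ⟩ := Valued.mem_nhds.mp hU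
  set v := MonoidWithZeroHom.ValueGroup₀.embedding γ.1 with hv
  have hv0 : v ≠ 0 := by simp [hv]
  obtain ⟨D, hD⟩ : ∃ D : ℕ, WithZero.exp (-(D : ℤ)) < v := by
    refine ⟨(1 - WithZero.log v).toNat, ?_⟩
    rw [← WithZero.lt_log_iff_exp_lt hv0]
    have := Int.self_le_toNat (1 - WithZero.log v)
    omega
  rw [Filter.mem_map, SummationFilter.unconditional_filter]
  refine Filter.mem_of_superset (Filter.mem_atTop (S D)) fun T hT => hγ ?_
  rw [Set.mem_ofPred_eq, Valued.v.restrict_lt_iff_lt_embedding]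
  refine lt_of_le_of_lt ?_ hD
  change Valued.v ((∑ i ∈ T, HahnSeries.ofPowerSeries ℤ K (P i))
    - HahnSeries.ofPowerSeries ℤ K h) ≤ _
  rw [← map_sum, ← map_sub, LaurentSeries.intValuation_le_iff_coeff_lt_eq_zero]
  intro N hN
  rw [map_sub, map_sum, ← hsum N, sub_eq_zero]
  exact (Finset.sum_subset ((hmono hN.le).trans hT) fun i _ hi => hzero N i hi).symm

/-- For `a ≥ b` the coefficient of `f` at `(a, b)` is the sum of `m(a + b - j, j)` over `j ≤ b`;
subtracting the one at `(a + 1, b - 1)` isolates `m(a, b)`. -/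
theorem IsMultiplicitySeries.coeff_eq {R : Type*} [CommRing R] {f M : MvPowerSeries (Fin 2) R}
    (h : IsMultiplicitySeries f M) (n : Fin 2 →₀ ℕ) :
    MvPowerSeries.coeff n M = if n 0 < n 1 then 0 else MvPowerSeries.coeff n f -
      if n 1 = 0 then 0 else MvPowerSeries.coeff (expo (n 0 + 1) (n 1 - 1)) f := by
  have hs : ∀ a b, b ≤ a → MvPowerSeries.coeff (expo a b) f
      = ∑ j ∈ Finset.range (b + 1), MvPowerSeries.coeff (expo (a + b - j) j) M := by
    intro a b hab
    have := h.expansion (expo a b)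
    rw [multiplicity_sum_eq] at this
    simpa [min_eq_right hab] using this
  split_ifs with h1 h2
  · exact h.support n h1
  · have e1 := hs (n 0) (n 1) (by omega)
    rw [expo_eta, h2, zero_add, Finset.sum_range_one, add_zero, Nat.sub_zero] at e1
    rw [e1, sub_zero, ← h2, expo_eta]
  · have e1 := hs (n 0) (n 1) (by omega)
    have e2 := hs (n 0 + 1) (n 1 - 1) (by omega)
    rw [Finset.sum_range_succ, expo_eta, Nat.add_sub_cancel, expo_eta] at e1
    rw [show n 1 - 1 + 1 = n 1 by omega, show n 0 + 1 + (n 1 - 1) = n 0 + n 1 by omega] at e2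
    rw [e1, e2, add_sub_cancel_left]

end Evaluation

/-! ### Matching the multiplicities with the monomial counts -/

section Count

open scoped RatFunc

variable {k : ℕ}

theorem weight_cellWeight_snd (d : Fin k → ℕ) (e : CellIndex d →₀ ℕ) :
    (Finsupp.weight (cellWeight d) e).2
      = (Finsupp.weight (cellExpo d) e 0 : ℤ) - Finsupp.weight (cellExpo d) e 1 := by
  induction e using Finsupp.induction_linear with
  | zero => simp
  | add a b ha hb => simp only [map_add, Prod.snd_add, Finsupp.add_apply, ha, hb]; push_cast; ring
  | single s c =>
    have hs := s.2.2
    have h : ((d s.1 - (s.2 : ℕ) : ℕ) : ℤ) = d s.1 - (s.2 : ℕ) := by omega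
    simp only [Finsupp.weight_single, cellWeight, Prod.smul_mk, Finsupp.smul_apply, cellExpo,
      expo_zero, expo_one, nsmul_eq_mul, smul_eq_mul, Nat.cast_mul, h]
    ring

theorem weight_cellExpo_le (d : Fin k → ℕ) (e : CellIndex d →₀ ℕ) :
    Finsupp.weight (cellExpo d) e 0 + Finsupp.weight (cellExpo d) e 1 ≤ e.degree * ∑ i, d i := by
  induction e using Finsupp.induction_linear with
  | zero => simp
  | add a b ha hb =>
    simp only [map_add, Finsupp.add_apply, add_mul]
    omega
  | single s c =>
    have hs := s.2.2
    have h1 : d s.1 ≤ ∑ i, d i :=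
      Finset.single_le_sum (fun _ _ => Nat.zero_le _) (Finset.mem_univ _)
    rw [Finsupp.weight_single, Finsupp.degree_single, Finsupp.smul_apply, Finsupp.smul_apply,
      smul_eq_mul, smul_eq_mul, ← mul_add, cellExpo, expo_zero, expo_one]
    exact Nat.mul_le_mul_left c (by omega)

theorem multidegreeSet_cellExpo_eq_empty {d : Fin k → ℕ} {N : ℕ} {n : Fin 2 →₀ ℕ}
    (h : N * ∑ i, d i < n 0 + n 1) : multidegreeSet (cellExpo d) Set.univ N n = ∅ := by
  rw [Set.eq_empty_iff_forall_notMem]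
  rintro e ⟨-, rfl, rfl⟩
  exact absurd (weight_cellExpo_le d e) (by omega)

theorem ncard_weightSet_zero (d : Fin k → ℕ) (N : ℕ) {B : ℕ} (hB : N * ∑ i, d i ≤ B) :
    (weightSet d N 0).ncard = ∑ p ∈ Finset.range (B + 1) ×ˢ Finset.range (B + 1),
      if p.1 < p.2 then 0 else (multidegreeSet (cellExpo d) Set.univ N (expo p.1 p.2)).ncard := by
  classical
  rw [Set.ncard_eq_toFinset_card _ (finite_weightSet d N 0),
    Finset.card_eq_sum_card_fiberwise (t := Finset.range (B + 1) ×ˢ Finset.range (B + 1))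
      (f := fun e => (Finsupp.weight (cellExpo d) e 0, Finsupp.weight (cellExpo d) e 1))]
  · refine Finset.sum_congr rfl fun p _ => ?_
    split_ifs with h
    · rw [Finset.card_eq_zero, Finset.filter_eq_empty_iff]
      rintro e he rfl
      have h2 := ((finite_weightSet d N 0).mem_toFinset.mp he).2
      rw [weight_cellWeight_snd] at h2
      dsimp only at h
      omega
    · rw [← Set.ncard_coe_finset]
      congr 1
      ext e
      simp only [Finset.coe_filter, Set.Finite.mem_toFinset, weightSet, weight_cellWeight_snd,
        multidegreeSet, Set.mem_ofPred_eq, Set.subset_univ, true_and, Prod.ext_iff]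
      constructor
      · rintro ⟨⟨h1, h2⟩, h3, h4⟩
        exact ⟨h1, by rw [← h3, ← h4, expo_eta]⟩
      · rintro ⟨h1, h2⟩
        simp only [h2, expo_zero, expo_one]
        exact ⟨⟨h1, by omega⟩, trivial, trivial⟩
  · intro e he
    have h1 := ((finite_weightSet d N 0).mem_toFinset.mp he).1
    have h2 := weight_cellExpo_le d e
    rw [h1] at h2
    simp only [Finset.coe_product, Set.mem_prod, Finset.coe_range, Set.mem_Iio]
    omega

theorem ncard_weightSet_two (d : Fin k → ℕ) (N : ℕ) {B : ℕ} (hB : N * ∑ i, d i ≤ B) :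
    (weightSet d N 2).ncard = ∑ p ∈ Finset.range (B + 1) ×ˢ Finset.range (B + 1),
      if p.1 < p.2 then 0 else if p.2 = 0 then 0 else
        (multidegreeSet (cellExpo d) Set.univ N (expo (p.1 + 1) (p.2 - 1))).ncard := by
  classical
  rw [Set.ncard_eq_toFinset_card _ (finite_weightSet d N 2),
    Finset.card_eq_sum_card_fiberwise (t := Finset.range (B + 1) ×ˢ Finset.range (B + 1))
      -- A monomial is filed under the partition whose subtracted term counts it, the inverse of
      -- `(a, b) ↦ (a + 1, b - 1)`. Weight at least 2 makes the truncated subtraction exact and the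
      -- result a partition.
      (f := fun e => (Finsupp.weight (cellExpo d) e 0 - 1, Finsupp.weight (cellExpo d) e 1 + 1))]
  · refine Finset.sum_congr rfl fun p _ => ?_
    split_ifs with h h0
    · rw [Finset.card_eq_zero, Finset.filter_eq_empty_iff]
      rintro e he rfl
      have h2 := ((finite_weightSet d N 2).mem_toFinset.mp he).2
      rw [weight_cellWeight_snd] at h2
      dsimp only at h
      omega
    · rw [Finset.card_eq_zero, Finset.filter_eq_empty_iff]
      rintro e he rfl
      dsimp only at h0
      omega
    · rw [← Set.ncard_coe_finset]
      congr 1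
      ext e
      simp only [Finset.coe_filter, Set.Finite.mem_toFinset, weightSet, weight_cellWeight_snd,
        multidegreeSet, Set.mem_ofPred_eq, Set.subset_univ, true_and, Prod.ext_iff]
      constructor
      · rintro ⟨⟨h1, h2⟩, h3, h4⟩
        refine ⟨h1, ?_⟩
        rw [← h3, ← h4, Nat.sub_add_cancel (by omega), Nat.add_sub_cancel, expo_eta]
      · rintro ⟨h1, h2⟩
        simp only [h2, expo_zero, expo_one]
        refine ⟨⟨h1, ?_⟩, ?_, ?_⟩ <;> omega
  · intro e he
    have h1 := ((finite_weightSet d N 2).mem_toFinset.mp he).1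
    have h3 := ((finite_weightSet d N 2).mem_toFinset.mp he).2
    have h2 := weight_cellExpo_le d e
    rw [h1] at h2
    rw [weight_cellWeight_snd] at h3
    simp only [Finset.coe_product, Set.mem_prod, Finset.coe_range, Set.mem_Iio]
    omega

theorem expo_injective : Function.Injective fun p : ℕ × ℕ => expo p.1 p.2 := by
  intro p q h
  have h0 := DFunLike.congr_fun h 0
  have h1 := DFunLike.congr_fun h 1
  simp only [expo_zero, expo_one] at h0 h1
  exact Prod.ext h0 h1

/-- The images in `K[[t]]` of the coefficients of the multiplicity series. -/
noncomputable def cellMultiplicity (K : Type*) [Field K] (d : Fin k → ℕ) (n : Fin 2 →₀ ℕ) :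
    PowerSeries K :=
  if n 0 < n 1 then 0 else
    MvPowerSeries.coeff n (multidegreeSeries K (cellExpo d) Set.univ) - if n 1 = 0 then 0 else
      MvPowerSeries.coeff (expo (n 0 + 1) (n 1 - 1)) (multidegreeSeries K (cellExpo d) Set.univ)

theorem coeff_multiplicitySeries_fSeries (K : Type*) [Field K] (d : Fin k → ℕ) (n : Fin 2 →₀ ℕ) :
    algebraMap (RatFunc K) (LaurentSeries K)
        (MvPowerSeries.coeff n (multiplicitySeries (fSeries K d)))
      = HahnSeries.ofPowerSeries ℤ K (cellMultiplicity K d n) := by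
  rw [(isMultiplicitySeries_multiplicitySeries _ (isSymmetricSeries_fSeries K d)).coeff_eq,
    cellMultiplicity]
  split_ifs <;> simp only [map_zero, map_sub, coeff_fSeries_coe]

theorem coeff_cellMultiplicity_eq_zero {K : Type*} [Field K] {d : Fin k → ℕ} {n : Fin 2 →₀ ℕ}
    {N : ℕ} (h : N * ∑ i, d i < n 0 + n 1) : PowerSeries.coeff N (cellMultiplicity K d n) = 0 := by
  rw [cellMultiplicity]
  split_ifs with h1 h2
  · simp
  · rw [sub_zero, coeff_multidegreeSeries, multidegreeSet_cellExpo_eq_empty h, Set.ncard_empty,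
      Nat.cast_zero]
  · rw [map_sub, coeff_multidegreeSeries, coeff_multidegreeSeries,
      multidegreeSet_cellExpo_eq_empty h, multidegreeSet_cellExpo_eq_empty (by
        rw [expo_zero, expo_one]; omega), sub_self]

theorem sum_coeff_cellMultiplicity (K : Type*) [Field K] (d : Fin k → ℕ) {N B : ℕ}
    (hB : N * ∑ i, d i ≤ B) :
    ∑ n ∈ (Finset.range (B + 1) ×ˢ Finset.range (B + 1)).map ⟨_, expo_injective⟩,
        PowerSeries.coeff N (cellMultiplicity K d n)
      = ((weightSet d N 0).ncard : K) - (weightSet d N 2).ncard := by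
  rw [ncard_weightSet_zero d N hB, ncard_weightSet_two d N hB, Finset.sum_map, Nat.cast_sum,
    Nat.cast_sum, ← Finset.sum_sub_distrib]
  refine Finset.sum_congr rfl fun p _ => ?_
  simp only [Function.Embedding.coeFn_mk, cellMultiplicity, expo_zero, expo_one]
  split_ifs <;> simp [coeff_multidegreeSeries]

end Count

/-! ### The Hilbert series as the value at `(1, 1)` -/

theorem mainTheorem3 {K : Type*} [Field K] [CharZero K] {m k : ℕ}
    (δ : Derivation K (MvPolynomial (Fin m) K) (MvPolynomial (Fin m) K))
    (hδ : IsWeitzenboeck δ) (d : Fin k → ℕ)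
    (hJ : HasJordanCells hδ.onLinearForms fun i => d i + 1) :
    IsSymmetricSeries (fSeries K d) ∧
      HasValueAt (multiplicitySeries (fSeries K d)) ![1, 1]
        (((hilbertSeriesOf (constantsAlgebra δ)).map (Int.castRingHom K) : PowerSeries K) :
          LaurentSeries K) := by
  refine ⟨isSymmetricSeries_fSeries K d, ?_⟩
  have hterm : ∀ n : Fin 2 →₀ ℕ,
      ((MvPowerSeries.coeff n (multiplicitySeries (fSeries K d)) : RatFunc K) : LaurentSeries K)
        * ∏ i, (![1, 1] : Fin 2 → LaurentSeries K) i ^ n i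
      = (cellMultiplicity K d n : LaurentSeries K) := by
    intro n
    rw [coeff_multiplicitySeries_fSeries]
    simp
  rw [HasValueAt]
  simp only [hterm]
  -- Monomials of degree `N` have total exponent at most `N * ∑ i, d i`, so a box of this side holds
  -- every partition contributing to `t^N`.
  refine hasSum_ofPowerSeries
    (fun N => (Finset.range (N * ∑ i, d i + 1) ×ˢ Finset.range (N * ∑ i, d i + 1)).map
      ⟨_, expo_injective⟩) ?_ ?_ ?_
  · intro N N' h
    have h1 : Finset.range (N * ∑ i, d i + 1) ⊆ Finset.range (N' * ∑ i, d i + 1) :=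
      Finset.range_mono (Nat.add_le_add_right (Nat.mul_le_mul_right _ h) 1)
    exact Finset.map_subset_map.mpr (Finset.product_subset_product h1 h1)
  · intro N n hn
    refine coeff_cellMultiplicity_eq_zero ?_
    by_contra! hle
    refine hn (Finset.mem_map.mpr ⟨(n 0, n 1), ?_, expo_eta n⟩)
    simp only [Finset.mem_product, Finset.mem_range]
    omega
  · intro N
    rw [sum_coeff_cellMultiplicity K d le_rfl, ← finrank_constantsAlgebra hδ hJ N, Nat.cast_add,
      add_sub_cancel_right, PowerSeries.coeff_map, hilbertSeriesOf, PowerSeries.coeff_mk]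
    simp
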